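/- Let $\mathbb F=\mathbb F_q$ be a finite field. *Definitions.* A matroid on a finite set $X$ is given by a rank function $r:2^X\to\mathbb N_0$ with $r(A)\le|A|$, $r$ monotone, and $r(A\cup B)+r(A\cap B)\le r(A)+r(B)$; it is representable over a field $K$ if there is a matrix over $K$ with columns indexed by $X$ such that $r(A)$ is the rank of the submatrix of the columns in $A$, for all $A\subseteq X$. A $q$-polymatroid on a finite-dimensional $\mathbb F$-space $E$ is given by a map $\rho$ from the subspaces of $E$ to $\mathbb Q_{\ge0}$ with $\rho(V)\le\dim V$, $\rho$ monotone, and $\rho(V+W)+\rho(V\cap W)\le\rho(V)+\rho(W)$; it is a $q$-matroid if $\rho$ takes values in $\mathbb N_0$. Two $q$-polymatroids are equivalent if an $\mathbb F$-isomorphism of the ground spaces carries one rank function to the other. For an $\mathbb F$-linear code $\mathcal C\le\mathbb F^{n\times m}$, the column $q$-polymatroid $\mathcal M_{\rm c}(\mathcal C)$ on $\mathbb F^n$ has rank function $\rho_{\rm c}(V)=\frac1m\big(\dim\mathcal C-\dim\{M\in\mathcal C:\operatorname{colsp}(M)\le V^\perp\}\big)$, where $V^\perp$ is taken with respect to the standard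 dot product. The code $\mathcal C$ is right $\mathbb F_{q^m}$-linear if, for some $X\in\mathrm{GL}_m(\mathbb F)$, the code $\mathcal CX$ is invariant under right multiplication by the companion matrix (ones on the superdiagonal, last row $f_0,\dots,f_{m-1}$) of the minimal polynomial $x^m-\sum_i f_ix^i$ over $\mathbb F$ of a primitive element of $\mathbb F_{q^m}$. A $q$-matroid on an $n$-dimensional space is $\mathbb F_{q^m}$-representable if it is equivalent to $\mathcal M_{\rm c}(\mathcal C)$ for some right $\mathbb F_{q^m}$-linear code $\mathcal C\le\mathbb F^{n\times m}$. Let $1\le k\le n$ and let $\mathcal A$ be a collection of $k$-subsets of $[n]$ with $|A\cap B|\le k-2$ for distinct $A,B\in\mathcal A$. Let $M_{[n],\mathcal A}$ be the matroid on $[n]$ with $r(X)=k-1$ if $X\in\mathcal A$ and $r(X)=\min\{|X|,k\}$ otherwise. For a basis $b=(b_1,\dots,b_n)$ of $\mathbb F^n$ put $\mathcal S=\{\langle b_i: i\in A\rangle: A\in\mathcal A\}$, and let $\mathcal M_{n,\mathbb F,\mathcal S}$ be the $q$-matroid on $\mathbb F^n$ with $\rho(V)=k-1$ if $V\in\mathcal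 S$ and $\rho(V)=\min\{\dim V,k\}$ otherwise. For a $q$-matroid $\mathcal M=(\mathbb F^n,\rho)$ let $M(\mathcal M,b)$ be the matroid on $[n]$ with rank function $A\mapsto\rho(\langle b_i:i\in A\rangle)$. *Statement.* Each of the following holds for every basis $b$ of $\mathbb F^n$. (a) Vámos matroid. Let $n=8$, $k=4$, $\mathcal A=\{1234,1456,2356,1478,2378\}$. Then $V_8=M_{[8],\mathcal A}$ is not representable over any field, $M(\mathcal M_{8,\mathbb F,\mathcal S},b)=V_8$, and $\mathcal M_{8,\mathbb F,\mathcal S}$ is not $\mathbb F_{q^m}$-representable for any $m\ge1$. The same three assertions hold for the non-Pappus matroid, $n=9$, $k=3$, $\mathcal A=\{123,456,157,247,168,348,269,359\}$. (b) Fano matroid. Let $n=7$, $k=3$, $\mathcal A=\{124,235,347,157,267,456,136\}$. Then $F_7=M_{[7],\mathcal A}$ is not representable over any field of odd characteristic, $M(\mathcal M_{7,\mathbb F,\mathcal S},b)=F_7$, and if $q$ is odd, then $\mathcal M_{7,\mathbb F,\mathcal S}$ is not $\mathbb F_{q^m}$-representable for any $m\ge1$. (c) Non-Fano matroid. Let $\mathcal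 A'$ be obtained from the collection $\mathcal A$ in (b) by omitting any one of its members, and let $\mathcal S'$ be the corresponding collection of subspaces. Then $F_7^-=M_{[7],\mathcal A'}$ is not representable over any field of characteristic $2$, $M(\mathcal M_{7,\mathbb F,\mathcal S'},b)=F_7^-$, and if $q$ is even, then $\mathcal M_{7,\mathbb F,\mathcal S'}$ is not $\mathbb F_{q^m}$-representable for any $m\ge1$. In particular, over every finite field $\mathbb F_q$ there is a $q$-matroid that is not $\mathbb F_{q^m}$-representable for any $m\ge1$; so the question of Jurrius and Pellikaan whether every $q$-matroid is representable has a negative answer. -/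

import Mathlib

universe u v w

/-! ### Classical matroids given by a rank function -/

/-- A matroid on the finite set `ι`, given by its rank function: (R1) `0 ≤ r A ≤ |A|`,
(R2) monotonicity, (R3) submodularity. -/
structure MatroidRank (ι : Type*) [DecidableEq ι] where
  r : Finset ι → ℕ
  r_le_card : ∀ A, r A ≤ A.card
  r_mono : ∀ A B, A ⊆ B → r A ≤ r B
  r_submod : ∀ A B, r (A ∪ B) + r (A ∩ B) ≤ r A + r B

namespace MatroidRank

variable {ι : Type*} [DecidableEq ι] (R : MatroidRank ι)

theorem r_empty : R.r ∅ = 0 := by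
  have := R.r_le_card ∅
  simpa using this

theorem r_union_eq (I S : Finset ι) (h : ∀ e ∈ S, R.r (insert e I) = R.r I) :
    R.r (I ∪ S) = R.r I := by
  induction S using Finset.induction_on with
  | empty => simp
  | insert e S he ih =>
    have ih' := ih (fun x hx => h x (Finset.mem_insert_of_mem hx))
    have h1 := h e (Finset.mem_insert_self e S)
    have h2 := R.r_submod (I ∪ S) (insert e I)
    have h3 : (I ∪ S) ∪ insert e I = I ∪ insert e S := by
      ext x; simp only [Finset.mem_union, Finset.mem_insert]; tauto
    have h4 : I ⊆ (I ∪ S) ∩ insert e I := by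
      intro x hx; simp [hx]
    have h5 := R.r_mono _ _ h4
    have h6 : R.r I ≤ R.r (I ∪ insert e S) := R.r_mono _ _ Finset.subset_union_left
    rw [h3] at h2
    omega

theorem indep_subset {I J : Finset ι} (hJ : R.r J = J.card) (hIJ : I ⊆ J) :
    R.r I = I.card := by
  have h1 := R.r_submod I (J \ I)
  have h2 := R.r_le_card (J \ I)
  have h3 := R.r_le_card I
  have h4 := Finset.card_sdiff_add_card_eq_card hIJ
  rw [Finset.union_sdiff_of_subset hIJ] at h1
  omega

theorem r_insert_of_dep {I : Finset ι} (hI : R.r I = I.card) {e : ι} (he : e ∉ I)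
    (hd : R.r (insert e I) ≠ (insert e I).card) : R.r (insert e I) = R.r I := by
  have h1 := R.r_le_card (insert e I)
  have h2 := R.r_mono I (insert e I) (Finset.subset_insert e I)
  rw [Finset.card_insert_of_notMem he] at h1 hd
  omega

theorem indep_aug {I J : Finset ι} (hI : R.r I = I.card) (hJ : R.r J = J.card)
    (hlt : I.card < J.card) : ∃ e ∈ J, e ∉ I ∧ R.r (insert e I) = (insert e I).card := by
  by_contra! hcon
  have h1 : R.r (I ∪ J) = R.r I := by
    refine R.r_union_eq I J fun e he => ?_
    by_cases heI : e ∈ I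
    · rw [Finset.insert_eq_of_mem heI]
    · exact R.r_insert_of_dep hI heI (hcon e he heI)
  have h2 : R.r J ≤ R.r (I ∪ J) := R.r_mono _ _ Finset.subset_union_right
  omega

/-- The matroid with ground set `ι` and rank function `r`: a set `I` is independent
iff `r I = |I|`. -/
def toMatroid : Matroid ι :=
  (IndepMatroid.ofFinset Set.univ (fun I => R.r I = I.card) R.r_empty
    (fun _ _ hJ hIJ => R.indep_subset hJ hIJ) (fun _ _ hI hJ hlt => R.indep_aug hI hJ hlt)
    (fun _ _ => Set.subset_univ _)).matroid

theorem toMatroid_E : R.toMatroid.E = Set.univ := rfl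

theorem toMatroid_indep (I : Finset ι) : R.toMatroid.Indep (I : Set ι) ↔ R.r I = I.card :=
  IndepMatroid.matroid_indep_iff.trans (IndepMatroid.ofFinset_indep ..)

/-- `toMatroid` has the prescribed rank function. -/
theorem toMatroid_eRk (A : Finset ι) : R.toMatroid.eRk (A : Set ι) = R.r A := by
  obtain ⟨I, hI⟩ := R.toMatroid.exists_isBasis (A : Set ι)
    (by rw [toMatroid_E]; exact Set.subset_univ _)
  have hfin : I.Finite := A.finite_toSet.subset hI.subset
  obtain ⟨I, rfl⟩ := hfin.exists_finset_coe
  rw [← hI.encard_eq_eRk, Set.encard_coe_eq_coe_finsetCard]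
  have hind : R.r I = I.card := (R.toMatroid_indep I).1 hI.indep
  have hsub : I ⊆ A := by exact_mod_cast hI.subset
  have h1 : R.r (I ∪ A) = R.r I := by
    refine R.r_union_eq I A fun e he => ?_
    by_cases heI : e ∈ I
    · rw [Finset.insert_eq_of_mem heI]
    · refine R.r_insert_of_dep hind heI fun hc => ?_
      have := (R.toMatroid_indep (insert e I)).2 hc
      have h2 := hI.eq_of_subset_indep this (by simp) (by
        intro x hx
        rcases Finset.mem_insert.1 (Finset.mem_coe.1 hx) with rfl | hx
        · exact he
        · exact hsub hx)
      rw [Finset.coe_inj] at h2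
      exact heI (h2 ▸ Finset.mem_insert_self e I)
  rw [Finset.union_eq_right.2 hsub] at h1
  rw [h1, hind]

end MatroidRank

/-- `M` is representable over `K`: there is a matrix over `K` whose columns are indexed by the
elements such that the rank of every set `A` is the rank of the submatrix of columns in `A`. -/
def Matroid.IsRepresentableOver {ι : Type*} (M : Matroid ι) (K : Type*) [Field K] : Prop :=
  ∃ (k : ℕ) (G : Matrix (Fin k) ι K), ∀ A : Finset ι,
    M.eRk (A : Set ι) = ((G.submatrix id (fun a : A => (a : ι))).rank : ℕ∞)

/-- A collection of `k`-subsets, `k ≥ 1`, any two distinct members of which meet in at most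
`k - 2` elements. -/
structure IsPavingSets {ι : Type*} [DecidableEq ι] (k : ℕ) (𝒜 : Finset (Finset ι)) : Prop where
  one_le : 1 ≤ k
  card_eq : ∀ A ∈ 𝒜, A.card = k
  inter_le : ∀ A ∈ 𝒜, ∀ B ∈ 𝒜, A ≠ B → (A ∩ B).card + 2 ≤ k

/-- The rank function with value `k - 1` on the members of `𝒜` and `min |X| k` elsewhere. -/
def pavingRank {ι : Type*} [DecidableEq ι] {k : ℕ} {𝒜 : Finset (Finset ι)}
    (h : IsPavingSets k 𝒜) : MatroidRank ι where
  r X := if X ∈ 𝒜 then k - 1 else min X.card k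
  r_le_card X := by
    have := h.card_eq X
    split_ifs with hX
    · have := this hX; omega
    · omega
  r_mono A B hAB := by
    have hA := h.card_eq A
    have hB := h.card_eq B
    have hle := Finset.card_le_card hAB
    have hk := h.one_le
    split_ifs with h1 h2 h2
    · omega
    · have := hA h1; omega
    · have := hB h2
      have hlt : A.card < B.card := Finset.card_lt_card (hAB.ssubset_of_ne (by
        rintro rfl; exact h1 h2))
      omega
    · omega
  r_submod A B := by
    have hk := h.one_le
    have hadd := Finset.card_union_add_card_inter A B
    have hU : (if A ∪ B ∈ 𝒜 then k - 1 else min (A ∪ B).card k) ≤ min (A ∪ B).card k := by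
      have := h.card_eq (A ∪ B)
      split_ifs with hc
      · have := this hc; omega
      · exact le_rfl
    have hI : (if A ∩ B ∈ 𝒜 then k - 1 else min (A ∩ B).card k) ≤ min (A ∩ B).card k := by
      have := h.card_eq (A ∩ B)
      split_ifs with hc
      · have := this hc; omega
      · exact le_rfl
    by_cases hAB : A ⊆ B
    · rw [Finset.union_eq_right.2 hAB, Finset.inter_eq_left.2 hAB, add_comm]
    by_cases hBA : B ⊆ A
    · rw [Finset.union_eq_left.2 hBA, Finset.inter_eq_right.2 hBA]
    have hlA : (A ∩ B).card < A.card := Finset.card_lt_card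
      (Finset.inter_subset_left.ssubset_of_ne (by rw [Ne, Finset.inter_eq_left]; exact hAB))
    have hlB : (A ∩ B).card < B.card := Finset.card_lt_card
      (Finset.inter_subset_right.ssubset_of_ne (by rw [Ne, Finset.inter_eq_right]; exact hBA))
    refine (add_le_add hU hI).trans ?_
    have hA := h.card_eq A
    have hB := h.card_eq B
    split_ifs with h1 h2 h2
    · have := h.inter_le A h1 B h2 (by rintro rfl; exact hAB subset_rfl)
      have := hA h1; have := hB h2; omega
    · have := hA h1; omega
    · have := hB h2; omega
    · omega

/-- The matroid `M_{ι,𝒜}`: a set `X` has rank `k - 1` if `X ∈ 𝒜` and `min |X| k` otherwise. -/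
def pavingMatroid {ι : Type*} [DecidableEq ι] (k : ℕ) (𝒜 : Finset (Finset ι))
    (h : IsPavingSets k 𝒜) : Matroid ι :=
  (pavingRank h).toMatroid

/-! ### `q`-polymatroids and `q`-matroids -/

/-- A `q`-polymatroid on the `F`-vector space `E`. -/
structure QPolymatroid (F E : Type*) [Field F] [AddCommGroup E] [Module F E] where
  rk : Submodule F E → ℚ
  rk_nonneg : ∀ V, 0 ≤ rk V
  rk_le_finrank : ∀ V, rk V ≤ Module.finrank F V
  rk_mono : ∀ V W, V ≤ W → rk V ≤ rk W
  rk_submod : ∀ V W, rk (V ⊔ W) + rk (V ⊓ W) ≤ rk V + rk W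

/-- A `q`-matroid: a `q`-polymatroid whose rank function takes values in the natural numbers. -/
structure QMatroid (F E : Type*) [Field F] [AddCommGroup E] [Module F E] extends
    QPolymatroid F E where
  rk_nat : ∀ V, ∃ k : ℕ, rk V = k

/-- Two `q`-polymatroids are equivalent if a linear isomorphism of the ground spaces carries
one rank function to the other. -/
def QPolymatroid.Equivalent {F E₁ E₂ : Type*} [Field F] [AddCommGroup E₁] [Module F E₁]
    [AddCommGroup E₂] [Module F E₂] (M₁ : QPolymatroid F E₁) (M₂ : QPolymatroid F E₂) : Prop :=
  ∃ α : E₁ ≃ₗ[F] E₂, ∀ V : Submodule F E₁,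
    M₂.rk (V.map (α : E₁ →ₗ[F] E₂)) = M₁.rk V

theorem span_basis_inf {F E ι : Type*} [Field F] [AddCommGroup E] [Module F E]
    (b : Module.Basis ι F E) (s t : Set ι) :
    Submodule.span F (b '' s) ⊓ Submodule.span F (b '' t) = Submodule.span F (b '' (s ∩ t)) := by
  ext x
  simp only [Submodule.mem_inf, Module.Basis.mem_span_image, Set.subset_inter_iff]

theorem finrank_span_basis {F E ι : Type*} [Field F] [AddCommGroup E] [Module F E]
    (b : Module.Basis ι F E) (A : Finset ι) :
    Module.finrank F (Submodule.span F (b '' (A : Set ι))) = A.card := by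
  classical
  have h := finrank_span_finset_eq_card (R := F) (s := A.image b) (by
    have := (b.linearIndependent.linearIndepOn (s := (A : Set ι))).id_image
    rw [Finset.coe_image]
    exact this)
  rw [Finset.coe_image, Finset.card_image_of_injective _ b.injective] at h
  exact h

/-- The matroid `M(ℳ, b)` induced by a `q`-matroid and a basis `b` of its ground space,
`A ↦ ρ(⟨b_i : i ∈ A⟩)`, with ground set the index set of the basis. -/
noncomputable def QMatroid.inducedRank {F E ι : Type*} [Field F] [AddCommGroup E] [Module F E]
    [DecidableEq ι] (M : QMatroid F E) (b : Module.Basis ι F E) : MatroidRank ι where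
  r A := ⌊M.rk (Submodule.span F (b '' (A : Set ι)))⌋₊
  r_le_card A := by
    have h := M.rk_le_finrank (Submodule.span F (b '' (A : Set ι)))
    rw [finrank_span_basis] at h
    exact Nat.floor_le_of_le h
  r_mono A B hAB := Nat.floor_le_floor (M.rk_mono _ _ (Submodule.span_mono
    (Set.image_mono (by exact_mod_cast hAB))))
  r_submod A B := by
    have h := M.rk_submod (Submodule.span F (b '' (A : Set ι)))
      (Submodule.span F (b '' (B : Set ι)))
    rw [span_basis_inf, ← Submodule.span_union, ← Set.image_union, ← Finset.coe_union,
      ← Finset.coe_inter] at h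
    obtain ⟨k₁, h₁⟩ := M.rk_nat (Submodule.span F (b '' ((A ∪ B : Finset ι) : Set ι)))
    obtain ⟨k₂, h₂⟩ := M.rk_nat (Submodule.span F (b '' ((A ∩ B : Finset ι) : Set ι)))
    obtain ⟨k₃, h₃⟩ := M.rk_nat (Submodule.span F (b '' (A : Set ι)))
    obtain ⟨k₄, h₄⟩ := M.rk_nat (Submodule.span F (b '' (B : Set ι)))
    rw [h₁, h₂, h₃, h₄] at h ⊢
    simp only [Nat.floor_natCast]
    exact_mod_cast h

/-- The matroid with rank function `QMatroid.inducedRank`. -/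
noncomputable def QMatroid.inducedMatroid {F E ι : Type*} [Field F] [AddCommGroup E] [Module F E]
    [DecidableEq ι] (M : QMatroid F E) (b : Module.Basis ι F E) : Matroid ι :=
  (M.inducedRank b).toMatroid

/-- A collection of `k`-spaces, `k ≥ 1`, any two distinct members of which meet in a space of
dimension at most `k - 2`. -/
structure IsPavingSpaces {F E : Type*} [Field F] [AddCommGroup E] [Module F E] (k : ℕ)
    (S : Set (Submodule F E)) : Prop where
  one_le : 1 ≤ k
  finrank_eq : ∀ V ∈ S, Module.finrank F V = k
  inf_le : ∀ V ∈ S, ∀ W ∈ S, V ≠ W → Module.finrank F (V ⊓ W : Submodule F E) + 2 ≤ k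

open Classical in
/-- The function `V ↦ k - 1` if `V ∈ S`, and `V ↦ min (dim V) k` otherwise. -/
noncomputable def qPavingRank {F E : Type*} [Field F] [AddCommGroup E] [Module F E] (k : ℕ)
    (S : Set (Submodule F E)) (V : Submodule F E) : ℕ :=
  if V ∈ S then k - 1 else min (Module.finrank F V) k

section

variable {F E : Type*} [Field F] [AddCommGroup E] [Module F E] {k : ℕ} {S : Set (Submodule F E)}

theorem qPavingRank_le (h : IsPavingSpaces k S) (V : Submodule F E) :
    qPavingRank k S V ≤ min (Module.finrank F V) k := by
  have := h.finrank_eq V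
  unfold qPavingRank
  split_ifs with hV
  · have := this hV; omega
  · exact le_rfl

theorem qPavingRank_mono [FiniteDimensional F E] (h : IsPavingSpaces k S) {V W : Submodule F E}
    (hVW : V ≤ W) : qPavingRank k S V ≤ qPavingRank k S W := by
  have hV := h.finrank_eq V
  have hW := h.finrank_eq W
  have hle := Submodule.finrank_mono hVW
  have hk := h.one_le
  unfold qPavingRank
  split_ifs with h1 h2 h2
  · omega
  · have := hV h1; omega
  · have := hW h2
    have hlt : Module.finrank F V < Module.finrank F W :=
      Submodule.finrank_lt_finrank_of_lt (lt_of_le_of_ne hVW (by rintro rfl; exact h1 h2))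
    omega
  · omega

theorem qPavingRank_submod [FiniteDimensional F E] (h : IsPavingSpaces k S)
    (V W : Submodule F E) :
    qPavingRank k S (V ⊔ W) + qPavingRank k S (V ⊓ W) ≤ qPavingRank k S V + qPavingRank k S W := by
  have hk := h.one_le
  have hadd := Submodule.finrank_sup_add_finrank_inf_eq V W
  by_cases hVW : V ≤ W
  · rw [sup_eq_right.2 hVW, inf_eq_left.2 hVW, add_comm]
  by_cases hWV : W ≤ V
  · rw [sup_eq_left.2 hWV, inf_eq_right.2 hWV]
  have hlV : Module.finrank F (V ⊓ W : Submodule F E) < Module.finrank F V :=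
    Submodule.finrank_lt_finrank_of_lt (inf_lt_left.2 hVW)
  have hlW : Module.finrank F (V ⊓ W : Submodule F E) < Module.finrank F W :=
    Submodule.finrank_lt_finrank_of_lt (inf_lt_right.2 hWV)
  refine (add_le_add (qPavingRank_le h _) (qPavingRank_le h _)).trans ?_
  have hV := h.finrank_eq V
  have hW := h.finrank_eq W
  unfold qPavingRank
  split_ifs with h1 h2 h2
  · have := h.inf_le V h1 W h2 (by rintro rfl; exact hVW le_rfl)
    have := hV h1; have := hW h2; omega
  · have := hV h1; omega
  · have := hW h2; omega
  · omega

/-- The `q`-matroid `ℳ_{n,F,S}` (for `E = F^n`): a subspace `V` has rank `k - 1` if `V ∈ S` and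
`min (dim V) k` otherwise. -/
noncomputable def pavingQMatroid [FiniteDimensional F E] (k : ℕ) (S : Set (Submodule F E))
    (h : IsPavingSpaces k S) : QMatroid F E where
  rk V := qPavingRank k S V
  rk_nonneg _ := Nat.cast_nonneg _
  rk_le_finrank V := by exact_mod_cast (qPavingRank_le h V).trans (min_le_left _ _)
  rk_mono _ _ hVW := by exact_mod_cast qPavingRank_mono h hVW
  rk_submod V W := by exact_mod_cast qPavingRank_submod h V W
  rk_nat V := ⟨qPavingRank k S V, rfl⟩

end

/-- The collection of the spaces `⟨b_i : i ∈ A⟩`, `A ∈ 𝒜`. -/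
def spanFamily {F E ι : Type*} [Field F] [AddCommGroup E] [Module F E]
    (b : Module.Basis ι F E) (𝒜 : Finset (Finset ι)) : Set (Submodule F E) :=
  {V | ∃ A ∈ 𝒜, V = Submodule.span F (b '' (A : Set ι))}

theorem IsPavingSets.spanFamily {F E ι : Type*} [Field F] [AddCommGroup E] [Module F E]
    [DecidableEq ι] (b : Module.Basis ι F E) {k : ℕ} {𝒜 : Finset (Finset ι)}
    (h : IsPavingSets k 𝒜) : IsPavingSpaces k (spanFamily b 𝒜) where
  one_le := h.one_le
  finrank_eq := by
    rintro _ ⟨A, hA, rfl⟩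
    rw [finrank_span_basis, h.card_eq A hA]
  inf_le := by
    rintro _ ⟨A, hA, rfl⟩ _ ⟨B, hB, rfl⟩ hne
    rw [span_basis_inf, ← Finset.coe_inter, finrank_span_basis]
    exact h.inter_le A hA B hB (by rintro rfl; exact hne rfl)

/-! ### Rank-metric codes and representability of `q`-matroids -/

section Codes

variable {F : Type*} [Field F] {n m : ℕ}

/-- The orthogonal space with respect to the standard dot product. -/
def dotPerp (V : Submodule F (Fin n → F)) : Submodule F (Fin n → F) where
  carrier := {w | ∀ v ∈ V, v ⬝ᵥ w = 0}
  add_mem' := by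
    intro x y hx hy v hv
    rw [dotProduct_add, hx v hv, hy v hv, add_zero]
  zero_mem' := fun v _ => dotProduct_zero v
  smul_mem' := by
    intro c x hx v hv
    rw [dotProduct_smul, hx v hv, smul_zero]

/-- The shortening `C(V, c)`: the matrices in `C` whose column space lies in `V`. -/
def shortening (C : Submodule F (Matrix (Fin n) (Fin m) F)) (V : Submodule F (Fin n → F)) :
    Submodule F (Matrix (Fin n) (Fin m) F) where
  carrier := {M | M ∈ C ∧ LinearMap.range M.mulVecLin ≤ V}
  add_mem' := by
    rintro M N ⟨hM, hM'⟩ ⟨hN, hN'⟩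
    refine ⟨C.add_mem hM hN, ?_⟩
    rintro _ ⟨x, rfl⟩
    rw [Matrix.mulVecLin_apply, Matrix.add_mulVec]
    exact V.add_mem (hM' ⟨x, rfl⟩) (hN' ⟨x, rfl⟩)
  zero_mem' := by
    refine ⟨C.zero_mem, ?_⟩
    rintro _ ⟨x, rfl⟩
    simp
  smul_mem' := by
    rintro c M ⟨hM, hM'⟩
    refine ⟨C.smul_mem c hM, ?_⟩
    rintro _ ⟨x, rfl⟩
    rw [Matrix.mulVecLin_apply, Matrix.smul_mulVec]
    exact V.smul_mem c (hM' ⟨x, rfl⟩)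

theorem mem_shortening_perp (C : Submodule F (Matrix (Fin n) (Fin m) F))
    (V : Submodule F (Fin n → F)) (M : Matrix (Fin n) (Fin m) F) :
    M ∈ shortening C (dotPerp V) ↔ M ∈ C ∧ ∀ v ∈ V, Matrix.vecMul v M = 0 := by
  refine and_congr_right fun _ => ⟨fun h v hv => ?_, fun h => ?_⟩
  · refine dotProduct_eq_zero _ fun x => ?_
    rw [← Matrix.dotProduct_mulVec]
    exact h ⟨x, rfl⟩ v hv
  · rintro _ ⟨x, rfl⟩ v hv
    rw [Matrix.mulVecLin_apply, Matrix.dotProduct_mulVec, h v hv, zero_dotProduct]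

theorem shortening_le (C : Submodule F (Matrix (Fin n) (Fin m) F)) (V : Submodule F (Fin n → F)) :
    shortening C V ≤ C := fun _ h => h.1

theorem shortening_perp_anti (C : Submodule F (Matrix (Fin n) (Fin m) F))
    {V W : Submodule F (Fin n → F)} (h : V ≤ W) :
    shortening C (dotPerp W) ≤ shortening C (dotPerp V) := by
  intro M hM
  rw [mem_shortening_perp] at hM ⊢
  exact ⟨hM.1, fun v hv => hM.2 v (h hv)⟩

theorem finrank_le_shortening_perp (C : Submodule F (Matrix (Fin n) (Fin m) F))
    (V : Submodule F (Fin n → F)) :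
    Module.finrank F C ≤
      Module.finrank F V * m + Module.finrank F (shortening C (dotPerp V)) := by
  let φ : C →ₗ[F] (V →ₗ[F] (Fin m → F)) :=
    { toFun := fun M => (Matrix.vecMulLinear (M : Matrix (Fin n) (Fin m) F)).comp V.subtype
      map_add' := fun M N => by ext; simp
      map_smul' := fun c M => by ext; simp }
  have h1 := LinearMap.finrank_range_add_finrank_ker φ
  have h2 : Module.finrank F (LinearMap.range φ) ≤ Module.finrank F V * m := by
    refine (Submodule.finrank_le _).trans ?_
    rw [Module.finrank_linearMap, Module.finrank_fin_fun]
  have h3 : Module.finrank F (LinearMap.ker φ) ≤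
      Module.finrank F (shortening C (dotPerp V)) := by
    let ψ : LinearMap.ker φ →ₗ[F] shortening C (dotPerp V) :=
      LinearMap.codRestrict _ (C.subtype.comp (LinearMap.ker φ).subtype) (fun M => by
        rw [mem_shortening_perp]
        refine ⟨M.1.2, fun v hv => ?_⟩
        exact LinearMap.congr_fun (LinearMap.mem_ker.1 M.2) ⟨v, hv⟩)
    refine LinearMap.finrank_le_finrank_of_injective (f := ψ) fun M N hMN => ?_
    have h := congrArg (Subtype.val : _ → Matrix (Fin n) (Fin m) F) hMN
    exact Subtype.ext (Subtype.ext h)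
  omega

/-- The column `q`-polymatroid `ℳ_c(C)` of a rank-metric code `C ≤ F^{n × m}`. -/
noncomputable def columnQPM (C : Submodule F (Matrix (Fin n) (Fin m) F)) :
    QPolymatroid F (Fin n → F) where
  rk V := ((Module.finrank F C : ℚ) - Module.finrank F (shortening C (dotPerp V))) / m
  rk_nonneg V := by
    refine div_nonneg (sub_nonneg.2 ?_) (Nat.cast_nonneg _)
    exact_mod_cast Submodule.finrank_mono (shortening_le C _)
  rk_le_finrank V := by
    refine div_le_of_le_mul₀ (Nat.cast_nonneg _) (Nat.cast_nonneg _) ?_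
    rw [sub_le_iff_le_add]
    exact_mod_cast finrank_le_shortening_perp C V
  rk_mono V W h := by
    refine div_le_div_of_nonneg_right (sub_le_sub_left ?_ _) (Nat.cast_nonneg _)
    exact_mod_cast Submodule.finrank_mono (shortening_perp_anti C h)
  rk_submod V W := by
    rw [← add_div, ← add_div]
    refine div_le_div_of_nonneg_right ?_ (Nat.cast_nonneg _)
    have h1 := Submodule.finrank_sup_add_finrank_inf_eq
      (shortening C (dotPerp V)) (shortening C (dotPerp W))
    have h2 : shortening C (dotPerp V) ⊓ shortening C (dotPerp W) ≤
        shortening C (dotPerp (V ⊔ W)) := by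
      rintro M ⟨hV, hW⟩
      rw [SetLike.mem_coe, mem_shortening_perp] at hV hW
      rw [mem_shortening_perp]
      refine ⟨hV.1, fun v hv => ?_⟩
      obtain ⟨x, hx, y, hy, rfl⟩ := Submodule.mem_sup.1 hv
      rw [Matrix.add_vecMul, hV.2 x hx, hW.2 y hy, add_zero]
    have h3 : shortening C (dotPerp V) ⊔ shortening C (dotPerp W) ≤
        shortening C (dotPerp (V ⊓ W)) :=
      sup_le (shortening_perp_anti C inf_le_left) (shortening_perp_anti C inf_le_right)
    have h2' := Submodule.finrank_mono h2
    have h3' := Submodule.finrank_mono h3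
    have h4 : Module.finrank F (shortening C (dotPerp V)) +
        Module.finrank F (shortening C (dotPerp W)) ≤
        Module.finrank F (shortening C (dotPerp (V ⊔ W))) +
        Module.finrank F (shortening C (dotPerp (V ⊓ W))) := by omega
    have h5 : (Module.finrank F (shortening C (dotPerp V)) : ℚ) +
        Module.finrank F (shortening C (dotPerp W)) ≤
        Module.finrank F (shortening C (dotPerp (V ⊔ W))) +
        Module.finrank F (shortening C (dotPerp (V ⊓ W))) := by exact_mod_cast h4
    linarith

/-- The companion matrix of `f = x^m - ∑ f_i x^i`: ones on the superdiagonal and last row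
`f_0, …, f_{m-1}`. -/
def companionMatrix (m : ℕ) (f : Polynomial F) : Matrix (Fin m) (Fin m) F :=
  Matrix.of fun i j =>
    if (i : ℕ) + 1 = m then -f.coeff j else if (j : ℕ) = i + 1 then 1 else 0

/-- A code `C ≤ F^{n × m}` is right linear over the extension field `K` of degree `m` of `F` if
for some `X ∈ GL_m(F)` the code `C X` is invariant under right multiplication by the companion
matrix of the minimal polynomial of a primitive element `ω` of `K`. -/
def IsRightLinear (K : Type*) [Field K] [Algebra F K]
    (C : Submodule F (Matrix (Fin n) (Fin (Module.finrank F K)) F)) : Prop :=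
  ∃ ω : Kˣ, (∀ x : Kˣ, x ∈ Subgroup.zpowers ω) ∧
    ∃ X : GL (Fin (Module.finrank F K)) F, ∀ M ∈ C, ∃ N ∈ C,
      M * X.val * companionMatrix (Module.finrank F K) (minpoly F (ω : K)) = N * X.val

end Codes

/-- A `q`-matroid is representable over the extension field `K = F_{q^m}` of `F = F_q` if it is
equivalent to the column `q`-polymatroid of a right `K`-linear code in `F^{n × m}`.
(The equivalence forces `n` to be the dimension of the ground space.) -/
def QMatroid.IsRepresentableOver {F E : Type*} [Field F] [AddCommGroup E] [Module F E]
    (M : QMatroid F E) (K : Type*) [Field K] [Algebra F K] : Prop :=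
  ∃ (n : ℕ) (C : Submodule F (Matrix (Fin n) (Fin (Module.finrank F K)) F)),
    IsRightLinear K C ∧ M.toQPolymatroid.Equivalent (columnQPM C)

/-! ### The Vámos, non-Pappus, Fano and non-Fano matroids

Elements are numbered from `0`: the element `i` below is the element `i + 1` of `[n]`. -/

/-- The five exceptional 4-sets `1234, 1456, 2356, 1478, 2378`. -/
def vamosSets : Finset (Finset (Fin 8)) :=
  {{0, 1, 2, 3}, {0, 3, 4, 5}, {1, 2, 4, 5}, {0, 3, 6, 7}, {1, 2, 6, 7}}

set_option maxRecDepth 10000 in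
theorem vamosSets_paving : IsPavingSets 4 vamosSets :=
  ⟨by decide, by decide, by decide⟩

/-- The eight lines `123, 456, 157, 247, 168, 348, 269, 359` of the non-Pappus configuration
(`789` is not a line). -/
def nonPappusLines : Finset (Finset (Fin 9)) :=
  {{0, 1, 2}, {3, 4, 5}, {0, 4, 6}, {1, 3, 6}, {0, 5, 7}, {2, 3, 7}, {1, 5, 8}, {2, 4, 8}}

set_option maxRecDepth 10000 in
theorem nonPappusLines_paving : IsPavingSets 3 nonPappusLines :=
  ⟨by decide, by decide, by decide⟩

/-- The seven lines `124, 235, 347, 157, 267, 456, 136` of the Fano plane. -/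
def fanoLines : Finset (Finset (Fin 7)) :=
  {{0, 1, 3}, {1, 2, 4}, {2, 3, 6}, {0, 4, 6}, {1, 5, 6}, {3, 4, 5}, {0, 2, 5}}

set_option maxRecDepth 10000 in
theorem fanoLines_paving : IsPavingSets 3 fanoLines :=
  ⟨by decide, by decide, by decide⟩

theorem nonFanoLines_paving (L : Finset (Fin 7)) : IsPavingSets 3 (fanoLines.erase L) :=
  ⟨by decide, fun A hA => fanoLines_paving.card_eq A (Finset.mem_of_mem_erase hA),
    fun A hA B hB => fanoLines_paving.inter_le A (Finset.mem_of_mem_erase hA) B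
      (Finset.mem_of_mem_erase hB)⟩

/-- The Vámos matroid `V_8`. -/
def vamosMatroid : Matroid (Fin 8) :=
  pavingMatroid 4 vamosSets vamosSets_paving

/-- The non-Pappus matroid. -/
def nonPappusMatroid : Matroid (Fin 9) :=
  pavingMatroid 3 nonPappusLines nonPappusLines_paving

/-- The Fano matroid `F_7`. -/
def fanoMatroid : Matroid (Fin 7) :=
  pavingMatroid 3 fanoLines fanoLines_paving

/-- The non-Fano matroid `F_7⁻` obtained by omitting the line `L`. -/
def nonFanoMatroid (L : Finset (Fin 7)) : Matroid (Fin 7) :=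
  pavingMatroid 3 (fanoLines.erase L) (nonFanoLines_paving L)

section

variable {F : Type*} [Field F]

/-- The `q`-matroid `ℳ_{8,F,S}` with `S` the spans of the exceptional sets of the Vámos matroid. -/
noncomputable def vamosQMatroid (b : Module.Basis (Fin 8) F (Fin 8 → F)) :
    QMatroid F (Fin 8 → F) :=
  pavingQMatroid 4 (spanFamily b vamosSets) (vamosSets_paving.spanFamily b)

/-- The `q`-matroid `ℳ_{9,F,S}` with `S` the spans of the lines of the non-Pappus matroid. -/
noncomputable def nonPappusQMatroid (b : Module.Basis (Fin 9) F (Fin 9 → F)) :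
    QMatroid F (Fin 9 → F) :=
  pavingQMatroid 3 (spanFamily b nonPappusLines) (nonPappusLines_paving.spanFamily b)

/-- The `q`-matroid `ℳ_{7,F,S}` with `S` the spans of the lines of the Fano plane. -/
noncomputable def fanoQMatroid (b : Module.Basis (Fin 7) F (Fin 7 → F)) :
    QMatroid F (Fin 7 → F) :=
  pavingQMatroid 3 (spanFamily b fanoLines) (fanoLines_paving.spanFamily b)

/-- The `q`-matroid `ℳ_{7,F,S}` with `S` the spans of the lines of the Fano plane other than
`L`. -/
noncomputable def nonFanoQMatroid (L : Finset (Fin 7)) (b : Module.Basis (Fin 7) F (Fin 7 → F)) :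
    QMatroid F (Fin 7 → F) :=
  pavingQMatroid 3 (spanFamily b (fanoLines.erase L)) ((nonFanoLines_paving L).spanFamily b)

end

open Module

/-! ### Codes that are linear over an extension field -/

/-! Representability of a `q`-matroid over `K = F_{q^m}` passes to the classical matroid it induces
on any basis. In coordinates in which the companion matrix becomes multiplication by the primitive
element `ω`, a right `K`-linear code is a `K`-subspace `D` of `K^n`, because `F[ω] = K`. The factor
`1/m` in `ρ_c` turns `F`-dimensions into `K`-dimensions, so `ρ_c(V)` is the codimension in `D` of
the common kernel of the functionals `c ↦ ∑ v_i c_i`, `v ∈ V`. By duality this is the dimension of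
the `K`-span of these functionals, and a set spanning `V` over `F` suffices to produce it
(`finrank_span_dotFunctional`). Hence the functionals attached to the images of the `b_i` under the
equivalence represent `M(ℳ, b)` over `K` (`QMatroid.exists_isVectorRep_of_isRepresentableOver`).

For the `q`-matroid built from the spans of the sets in `𝒜`, the induced matroid is the paving
matroid of `𝒜` (`inducedRank_pavingQMatroid`). Both kinds of nonrepresentability therefore follow
from one statement: no family of vectors over `K` has the given rank function. Choosing a basis
among the vectors turns this into vanishing and nonvanishing of determinants
(`IsVectorRep.exists_coordinates`), and classical projective geometry supplies the contradiction.
Concurrent lines force a sixth coplanar quadruple in the Vámos configuration, Pappus' theorem forces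
the ninth line, and in the Fano configuration the last line is present exactly when `2 = 0`. The
characteristic of `K` is that of `F`, which brings in the parity of `q`. The Vámos argument needs no
condition on `q`, so it gives an example over every finite field. -/

theorem adjoin_eq_top_of_forall_mem_zpowers {F K : Type*} [Field F] [Field K] [Algebra F K]
    [FiniteDimensional F K] {ω : Kˣ} (hω : ∀ x : Kˣ, x ∈ Subgroup.zpowers ω) :
    Algebra.adjoin F {(ω : K)} = ⊤ := by
  rw [← IntermediateField.adjoin_simple_toSubalgebra_of_isAlgebraic
    (Algebra.IsAlgebraic.isAlgebraic _),
    eq_top_iff]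
  rintro x -
  rw [IntermediateField.mem_toSubalgebra]
  rcases eq_or_ne x 0 with rfl | hx
  · exact zero_mem _
  · obtain ⟨z, hz⟩ := hω (Units.mk0 x hx)
    have hz' : x = (ω : K) ^ z := by
      rw [← Units.val_zpow_eq_zpow_val]
      exact (congrArg Units.val hz).symm
    rw [hz']
    exact zpow_mem (IntermediateField.mem_adjoin_simple_self F _) z

/-- Every row but the last shifts the exponent by one. The last row expresses `ω ^ m` through lower
powers by the minimal polynomial, and only there does the degree hypothesis enter. -/
theorem sum_companionMatrix_smul_pow {F K : Type*} [Field F] [Field K] [Algebra F K]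
    [FiniteDimensional F K] {m : ℕ} {ω : K} (hm : (minpoly F ω).natDegree = m) (i : Fin m) :
    ∑ j, companionMatrix m (minpoly F ω) i j • ω ^ (j : ℕ) = ω ^ ((i : ℕ) + 1) := by
  simp only [companionMatrix, Matrix.of_apply]
  by_cases hi : (i : ℕ) + 1 = m
  · simp only [if_pos hi]
    have h := minpoly.aeval F ω
    have hmonic := (minpoly.monic (Algebra.IsIntegral.isIntegral (R := F) ω)).coeff_natDegree
    rw [Polynomial.aeval_eq_sum_range, Finset.sum_range_succ, hmonic, one_smul, hm,
      ← Fin.sum_univ_eq_sum_range (fun j => (minpoly F ω).coeff j • ω ^ j)] at h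
    simp only [neg_smul, Finset.sum_neg_distrib, hi]
    linear_combination -h
  · simp only [if_neg hi]
    have hlt : (i : ℕ) + 1 < m := by have := i.2; omega
    rw [Finset.sum_eq_single ⟨(i : ℕ) + 1, hlt⟩]
    · simp
    · intro j _ hj
      rw [if_neg, zero_smul]
      exact fun h => hj (Fin.ext h)
    · simp

/-- Right multiplication by the companion matrix of the minimal polynomial of a generator `ω`
is multiplication by `ω` in suitable coordinates. -/
theorem exists_linearEquiv_companionMatrix {F K : Type*} [Field F] [Field K] [Algebra F K]
    [FiniteDimensional F K] {ω : K} (hω : Algebra.adjoin F {ω} = ⊤) :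
    ∃ e : (Fin (finrank F K) → F) ≃ₗ[F] K, ∀ v,
      e (Matrix.vecMul v (companionMatrix (finrank F K) (minpoly F ω))) = ω * e v := by
  let pb := PowerBasis.ofAdjoinEqTop (Algebra.IsIntegral.isIntegral (R := F) ω) hω
  have hdim : pb.dim = finrank F K := pb.finrank.symm
  have hm : (minpoly F ω).natDegree = finrank F K := hdim
  let B := pb.basis.reindex (finCongr hdim)
  have hB : ∀ i, B i = ω ^ (i : ℕ) := by
    intro i
    simp only [B, Basis.reindex_apply, PowerBasis.basis_eq_pow]
    rfl
  refine ⟨B.equivFun.symm, fun v => ?_⟩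
  simp only [Basis.equivFun_symm_apply, hB]
  simp only [Matrix.vecMul, dotProduct, Finset.sum_smul, Finset.mul_sum]
  rw [Finset.sum_comm]
  refine Finset.sum_congr rfl fun i _ => ?_
  simp only [mul_smul, ← Finset.smul_sum]
  rw [sum_companionMatrix_smul_pow hm, pow_succ', mul_smul_comm]

/-! ### Right linear codes as `K`-subspaces of `K ^ n` -/

section

variable {F K : Type*} [Field F] [Field K] [Algebra F K] {n : ℕ}

/-- The `K`-subspace of the vectors `c ∈ C` with `∑ i, v i • c i = 0` for all `v ∈ V`. -/
def vectorShortening (C : Submodule K (Fin n → K)) (V : Submodule F (Fin n → F)) :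
    Submodule K (Fin n → K) where
  carrier := {c | c ∈ C ∧ ∀ v ∈ V, ∑ i, v i • c i = 0}
  add_mem' := by
    rintro c d ⟨hc, hc'⟩ ⟨hd, hd'⟩
    refine ⟨C.add_mem hc hd, fun v hv => ?_⟩
    simp only [Pi.add_apply, smul_add, Finset.sum_add_distrib, hc' v hv, hd' v hv, add_zero]
  zero_mem' := ⟨C.zero_mem, by simp⟩
  smul_mem' := by
    rintro a c ⟨hc, hc'⟩
    refine ⟨C.smul_mem a hc, fun v hv => ?_⟩
    simp only [Pi.smul_apply, smul_comm _ a, ← Finset.smul_sum, hc' v hv, smul_zero]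

theorem mem_vectorShortening {C : Submodule K (Fin n → K)} {V : Submodule F (Fin n → F)}
    {c : Fin n → K} : c ∈ vectorShortening C V ↔ c ∈ C ∧ ∀ v ∈ V, ∑ i, v i • c i = 0 :=
  Iff.rfl

/-- A right `K`-linear code is the same as a `K`-subspace of `K ^ n`, with the same column
`q`-polymatroid. -/
theorem IsRightLinear.exists_submodule [FiniteDimensional F K]
    {C : Submodule F (Matrix (Fin n) (Fin (finrank F K)) F)} (hC : IsRightLinear K C) :
    ∃ D : Submodule K (Fin n → K), ∀ V : Submodule F (Fin n → F),
      (columnQPM C).rk V = (finrank K D : ℚ) - finrank K (vectorShortening D V) := by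
  obtain ⟨ω, hω, X, hX⟩ := hC
  have htop := adjoin_eq_top_of_forall_mem_zpowers (F := F) hω
  obtain ⟨e, he⟩ := exists_linearEquiv_companionMatrix htop
  let φ : Matrix (Fin n) (Fin (finrank F K)) F →ₗ[F] (Fin n → K) :=
    { toFun := fun M i => e ((M * X.val) i)
      map_add' := fun M N => by
        ext i; rw [Matrix.add_mul]; exact map_add e _ _
      map_smul' := fun a M => by
        ext i; rw [Matrix.smul_mul]; exact map_smul e _ _ }
  have hφ_apply : ∀ M i, φ M i = e ((M * X.val) i) := fun _ _ => rfl
  have hXinj : ∀ {l : Type} (M N : Matrix l (Fin (finrank F K)) F),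
      M * X.val = N * X.val → M = N := by
    intro l M N h
    have h2 := congrArg (· * (X⁻¹).val) h
    simpa [Matrix.mul_assoc, ← Units.val_mul] using h2
  have hφ : Function.Injective φ := by
    intro M N h
    refine hXinj M N (funext fun i => e.injective (congrFun h i))
  have hφ_sum : ∀ M (v : Fin n → F), ∑ i, v i • φ M i = 0 ↔ Matrix.vecMul v M = 0 := by
    intro M v
    have h1 : ∑ i, v i • φ M i = e (Matrix.vecMul (Matrix.vecMul v M) X.val) := by
      rw [Matrix.vecMul_vecMul, Matrix.vecMul_eq_sum, map_sum]
      simp only [hφ_apply, map_smul]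
    rw [h1, LinearEquiv.map_eq_zero_iff]
    refine ⟨fun h => ?_, fun h => by rw [h, Matrix.zero_vecMul]⟩
    have h2 := congrArg (fun w => Matrix.vecMul w (X⁻¹).val) h
    simpa [Matrix.vecMul_vecMul, ← Units.val_mul] using h2
  -- The companion matrix gives stability under `ω` alone; since `ω` generates `K` as an
  -- `F`-algebra, stability under every scalar of `K` follows by induction on the adjunction.
  have hstable : ∀ a : K, ∀ c ∈ C.map φ, a • c ∈ C.map φ := by
    intro a
    have ha : a ∈ Algebra.adjoin F {(ω : K)} := htop ▸ Algebra.mem_top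
    induction ha using Algebra.adjoin_induction with
    | mem x hx =>
      obtain rfl := Set.mem_singleton_iff.1 hx
      rintro _ ⟨M, hM, rfl⟩
      obtain ⟨N, hN, hMN⟩ := hX M hM
      refine ⟨N, hN, funext fun i => ?_⟩
      rw [hφ_apply, ← hMN, Matrix.mul_apply_eq_vecMul, he]
      rfl
    | algebraMap r =>
      intro c hc
      rw [algebraMap_smul]
      exact Submodule.smul_mem _ r hc
    | add x y _ _ hx hy =>
      intro c hc
      rw [add_smul]
      exact Submodule.add_mem _ (hx c hc) (hy c hc)
    | mul x y _ _ hx hy =>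
      intro c hc
      rw [mul_smul]
      exact hx _ (hy c hc)
  let D : Submodule K (Fin n → K) :=
    { carrier := C.map φ
      add_mem' := fun ha hb => Submodule.add_mem _ ha hb
      zero_mem' := Submodule.zero_mem _
      smul_mem' := fun a c hc => hstable a c hc }
  -- The factor `finrank F K` produced here, for `C` and for its shortenings alike, cancels the
  -- denominator `m` of `ρ_c`.
  have hfin : ∀ (A : Submodule F (Matrix (Fin n) (Fin (finrank F K)) F))
      (B : Submodule K (Fin n → K)), (A.map φ : Submodule F _) = B.restrictScalars F →
      finrank F A = finrank F K * finrank K B := by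
    intro A B hAB
    rw [finrank_mul_finrank F K B, (Submodule.equivMapOfInjective φ hφ A).finrank_eq, hAB]
    rfl
  refine ⟨D, fun V => ?_⟩
  have h1 : finrank F C = finrank F K * finrank K D := hfin C D rfl
  have h2 : finrank F (shortening C (dotPerp V)) =
      finrank F K * finrank K (vectorShortening D V) := by
    refine hfin _ _ ?_
    ext c
    rw [Submodule.restrictScalars_mem, mem_vectorShortening, Submodule.mem_map]
    constructor
    · rintro ⟨M, hM, rfl⟩
      rw [mem_shortening_perp] at hM
      exact ⟨⟨M, hM.1, rfl⟩, fun v hv => (hφ_sum M v).2 (hM.2 v hv)⟩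
    · rintro ⟨⟨M, hM, rfl⟩, h⟩
      exact ⟨M, (mem_shortening_perp C V M).2 ⟨hM, fun v hv => (hφ_sum M v).1 (h v hv)⟩, rfl⟩
  have hpos : (finrank F K : ℚ) ≠ 0 := by exact_mod_cast (finrank_pos (R := F) (M := K)).ne'
  change ((finrank F C : ℚ) - finrank F (shortening C (dotPerp V))) / finrank F K = _
  rw [h1, h2]
  push_cast
  field_simp

/-- The functional `c ↦ ∑ i, v i • c i` on a subspace of `K ^ n`. -/
def dotFunctional (D : Submodule K (Fin n → K)) (v : Fin n → F) : Dual K D where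
  toFun c := ∑ i, v i • (c : Fin n → K) i
  map_add' c d := by simp [Finset.sum_add_distrib]
  map_smul' a c := by
    simp only [Submodule.coe_smul, Pi.smul_apply, smul_comm _ a, ← Finset.smul_sum,
      RingHom.id_apply]

/-- The shortening is the common kernel of the functionals, and a space of functionals and its
common kernel have complementary dimensions. Passing from `s` to its `F`-span does not change the
kernel, since `v ↦ ∑ v_i c_i` is `F`-linear. -/
theorem finrank_span_dotFunctional (D : Submodule K (Fin n → K)) (s : Set (Fin n → F)) :
    finrank K (Submodule.span K (dotFunctional D '' s)) +
      finrank K (vectorShortening D (Submodule.span F s)) = finrank K D := by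
  rw [← Subspace.finrank_add_finrank_dualCoannihilator_eq
    (Submodule.span K (dotFunctional D '' s))]
  congr 1
  have h : ((Submodule.span K (dotFunctional D '' s)).dualCoannihilator.map D.subtype) =
      vectorShortening D (Submodule.span F s) := by
    ext c
    rw [mem_vectorShortening, Submodule.mem_map]
    constructor
    · rintro ⟨d, hd, rfl⟩
      refine ⟨d.2, fun v hv => ?_⟩
      rw [Submodule.mem_dualCoannihilator] at hd
      induction hv using Submodule.span_induction with
      | mem v hv => exact hd _ (Submodule.subset_span ⟨v, hv, rfl⟩)
      | zero => simp
      | add v w _ _ hv hw => simp only [Pi.add_apply, add_smul, Finset.sum_add_distrib, hv, hw,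
          add_zero]
      | smul a v _ hv => simp only [Pi.smul_apply, smul_eq_mul, mul_smul, ← Finset.smul_sum, hv,
          smul_zero]
    · rintro ⟨hc, h⟩
      refine ⟨⟨c, hc⟩, ?_, rfl⟩
      rw [Submodule.mem_dualCoannihilator]
      intro f hf
      induction hf using Submodule.span_induction with
      | mem f hf =>
        obtain ⟨v, hv, rfl⟩ := hf
        exact h v (Submodule.subset_span hv)
      | zero => rfl
      | add f g _ _ hf hg => rw [LinearMap.add_apply, hf, hg, add_zero]
      | smul a f _ hf => rw [LinearMap.smul_apply, hf, smul_zero]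
  rw [← h, (Submodule.equivMapOfInjective D.subtype D.injective_subtype _).finrank_eq]

end

/-! ### Vector representations -/

/-- The vectors `x i` represent the rank function `r` over `K`. -/
def IsVectorRep (K : Type*) {ι W : Type*} [Field K] [AddCommGroup W] [Module K W]
    (r : Finset ι → ℕ) (x : ι → W) : Prop :=
  ∀ A : Finset ι, finrank K (Submodule.span K (x '' (A : Set ι))) = r A

theorem MatroidRank.exists_isVectorRep_of_isRepresentableOver {ι K : Type*} [DecidableEq ι]
    [Field K] (R : MatroidRank ι) (h : R.toMatroid.IsRepresentableOver K) :
    ∃ (k : ℕ) (x : ι → Fin k → K), IsVectorRep K R.r x := by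
  obtain ⟨k, G, hG⟩ := h
  refine ⟨k, G.col, fun A => ?_⟩
  have h1 := hG A
  rw [R.toMatroid_eRk, Matrix.rank_eq_finrank_span_cols] at h1
  have h2 : Set.range (G.submatrix id (fun a : A => (a : ι))).col = G.col '' (A : Set ι) := by
    rw [Set.image_eq_range]
    rfl
  rw [h2] at h1
  exact_mod_cast h1.symm

/-- The bridge from `q`-matroids to matroids: the functionals on `D` defined by the vectors `α (b
i)` are the representing vectors. -/
theorem QMatroid.exists_isVectorRep_of_isRepresentableOver {F E ι : Type*} {K : Type w}
    [Field F] [AddCommGroup E] [Module F E] [DecidableEq ι] [Field K] [Algebra F K]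
    [FiniteDimensional F K] (M : QMatroid F E) (b : Basis ι F E) (h : M.IsRepresentableOver K) :
    ∃ (W : Type w) (_ : AddCommGroup W) (_ : Module K W) (x : ι → W),
      IsVectorRep K (M.inducedRank b).r x := by
  obtain ⟨n, C, hC, α, hα⟩ := h
  obtain ⟨D, hD⟩ := hC.exists_submodule
  refine ⟨Dual K D, inferInstance, inferInstance, fun i => dotFunctional D (α (b i)), fun A => ?_⟩
  have h1 := hα (Submodule.span F (b '' (A : Set ι)))
  rw [hD, Submodule.map_span] at h1
  have h2 := finrank_span_dotFunctional D (α '' (b '' (A : Set ι)))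
  have h3 : (fun i => dotFunctional D (α (b i))) '' (A : Set ι) =
      dotFunctional D '' (α '' (b '' (A : Set ι))) := by
    rw [Set.image_image, Set.image_image]
  rw [h3]
  change _ = ⌊M.rk (Submodule.span F (b '' (A : Set ι)))⌋₊
  -- With `dim D` written as a sum, the rational rank is the cast of a natural number, so the floor
  -- is exact.
  rw [← h1, ← h2]
  simp

/-- Coordinates of a vector representation of a paving matroid with respect to a basis: a
`k`-tuple of vectors is dependent iff it is one of the exceptional sets. -/
theorem IsVectorRep.exists_coordinates {K ι W : Type*} [Field K] [AddCommGroup W] [Module K W]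
    [DecidableEq ι] [Fintype ι] {k : ℕ} {𝒜 : Finset (Finset ι)} {h : IsPavingSets k 𝒜} {x : ι → W}
    (hx : IsVectorRep K (pavingRank h).r x) (s₀ : Fin k → ι) (hs₀ : Function.Injective s₀)
    (hs₀' : Finset.univ.image s₀ ∉ 𝒜) (huniv : Finset.univ ∉ 𝒜) :
    ∃ y : ι → Fin k → K, (∀ j, y (s₀ j) = Pi.single j 1) ∧
      ∀ s : Fin k → ι, Function.Injective s →
        ((Matrix.of fun i => y (s i)).det = 0 ↔ Finset.univ.image s ∈ 𝒜) := by
  have hindep : ∀ s : Fin k → ι, Function.Injective s →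
      (LinearIndependent K (x ∘ s) ↔ Finset.univ.image s ∉ 𝒜) := by
    intro s hs
    have h1 := hx (Finset.univ.image s)
    have hk := h.one_le
    have hc : (Finset.univ.image s).card = k := by simp [Finset.card_image_of_injective _ hs]
    rw [linearIndependent_iff_card_eq_finrank_span, Set.finrank, Fintype.card_fin]
    rw [Finset.coe_image, Finset.coe_univ, Set.image_univ, ← Set.range_comp] at h1
    rw [h1]
    simp only [pavingRank, hc]
    split_ifs with h2
    · simp [h2]; omega
    · simp [h2]
  have hpos : 0 < k := h.one_le
  have : Nonempty (Fin k) := ⟨⟨0, hpos⟩⟩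
  let U := Submodule.span K (Set.range x)
  -- The full rank is `k` because `univ ∉ 𝒜` and `s₀` embeds `k` elements. Hence the independent
  -- vectors `x (s₀ j)` form a basis of their ambient span `U`, and coordinates are taken there.
  have hU : finrank K U = k := by
    have h1 := hx Finset.univ
    have h2 : k ≤ Fintype.card ι := by simpa using Fintype.card_le_of_injective s₀ hs₀
    rw [Finset.coe_univ, Set.image_univ] at h1
    rw [h1]
    simp [pavingRank, huniv, h2]
  let z : ι → U := fun i => ⟨x i, Submodule.subset_span ⟨i, rfl⟩⟩
  have hz : ∀ s : Fin k → ι, LinearIndependent K (z ∘ s) ↔ LinearIndependent K (x ∘ s) := by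
    intro s
    exact (LinearMap.linearIndependent_iff U.subtype (v := z ∘ s) U.ker_subtype).symm
  let B := basisOfLinearIndependentOfCardEqFinrank ((hz s₀).2 ((hindep s₀ hs₀).2 hs₀'))
    (by rw [Fintype.card_fin, hU])
  have hB : ∀ j, B j = z (s₀ j) := fun j => by simp [B]
  refine ⟨fun i => B.equivFun (z i), fun j => ?_, fun s hs => ?_⟩
  · ext l
    dsimp only
    rw [← hB, Basis.equivFun_self, Pi.single_apply]
    simp [eq_comm]
  · rw [← not_iff_not, ← hindep s hs, ← hz, ← Ne, ← isUnit_iff_ne_zero,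
      ← Matrix.isUnit_iff_isUnit_det,
      ← Matrix.linearIndependent_rows_iff_isUnit,
      ← LinearMap.linearIndependent_iff B.equivFun.toLinearMap B.equivFun.ker]
    rfl

/-! ### The matroid induced by a paving `q`-matroid -/

theorem span_mem_spanFamily_iff {F E ι : Type*} [Field F] [AddCommGroup E] [Module F E]
    (b : Basis ι F E) {𝒜 : Finset (Finset ι)} {A : Finset ι} :
    Submodule.span F (b '' (A : Set ι)) ∈ spanFamily b 𝒜 ↔ A ∈ 𝒜 := by
  refine ⟨?_, fun h => ⟨A, h, rfl⟩⟩
  rintro ⟨B, hB, h⟩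
  have hAB : A = B := by
    ext i
    rw [← Finset.mem_coe, ← b.self_mem_span_image (R := F), h, b.self_mem_span_image,
      Finset.mem_coe]
  rwa [hAB]

theorem inducedRank_pavingQMatroid {F E ι : Type*} [Field F] [AddCommGroup E] [Module F E]
    [FiniteDimensional F E] [DecidableEq ι] (b : Basis ι F E) {k : ℕ} {𝒜 : Finset (Finset ι)}
    (h : IsPavingSets k 𝒜) :
    (pavingQMatroid k (spanFamily b 𝒜) (h.spanFamily b)).inducedRank b = pavingRank h := by
  have hr : ((pavingQMatroid k (spanFamily b 𝒜) (h.spanFamily b)).inducedRank b).r =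
      (pavingRank h).r := by
    funext A
    simp [QMatroid.inducedRank, pavingQMatroid, pavingRank, qPavingRank, span_mem_spanFamily_iff,
      finrank_span_basis]
    split_ifs <;> simp [← Nat.cast_min]
  -- The remaining fields of `MatroidRank` are proofs, so equality of the functions `r` is enough.
  generalize (pavingQMatroid k (spanFamily b 𝒜) (h.spanFamily b)).inducedRank b = R at hr
  cases R
  cases hr
  rfl

/-! ### The four configurations -/

section Configurations

variable {K : Type*} [Field K] {W : Type*} [AddCommGroup W] [Module K W]

theorem det_of_fin_three (a b c : Fin 3 → K) :
    (Matrix.of ![a, b, c]).det = a 0 * (b 1 * c 2 - b 2 * c 1) - a 1 * (b 0 * c 2 - b 2 * c 0) +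
      a 2 * (b 0 * c 1 - b 1 * c 0) := by
  rw [Matrix.det_fin_three]
  simp only [Matrix.of_apply, Matrix.cons_val]
  ring

theorem det_of_fin_four (a b c d : Fin 4 → K) :
    (Matrix.of ![a, b, c, d]).det =
      a 0 * (b 1 * (c 2 * d 3 - c 3 * d 2) - b 2 * (c 1 * d 3 - c 3 * d 1) +
        b 3 * (c 1 * d 2 - c 2 * d 1)) -
      a 1 * (b 0 * (c 2 * d 3 - c 3 * d 2) - b 2 * (c 0 * d 3 - c 3 * d 0) +
        b 3 * (c 0 * d 2 - c 2 * d 0)) +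
      a 2 * (b 0 * (c 1 * d 3 - c 3 * d 1) - b 1 * (c 0 * d 3 - c 3 * d 0) +
        b 3 * (c 0 * d 1 - c 1 * d 0)) -
      a 3 * (b 0 * (c 1 * d 2 - c 2 * d 1) - b 1 * (c 0 * d 2 - c 2 * d 0) +
        b 2 * (c 0 * d 1 - c 1 * d 0)) := by
  simp [Matrix.det_succ_row_zero, Fin.sum_univ_succ, Fin.succAbove]
  ring

theorem exists_coordinates_fin_three {ι : Type*} [DecidableEq ι] [Fintype ι]
    {𝒜 : Finset (Finset ι)} {h : IsPavingSets 3 𝒜} {x : ι → W}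
    (hx : IsVectorRep K (pavingRank h).r x) (p q r : ι) (hpqr : [p, q, r].Nodup)
    (hpqr' : {p, q, r} ∉ 𝒜) (huniv : Finset.univ ∉ 𝒜) :
    ∃ y : ι → Fin 3 → K, (y p = ![1, 0, 0] ∧ y q = ![0, 1, 0] ∧ y r = ![0, 0, 1]) ∧
      ∀ i j l : ι, [i, j, l].Nodup →
        ((Matrix.of ![y i, y j, y l]).det = 0 ↔ {i, j, l} ∈ 𝒜) := by
  have hinj : ∀ i j l : ι, [i, j, l].Nodup → Function.Injective ![i, j, l] := fun i j l hn => by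
    have := List.nodup_iff_injective_get.1 hn
    exact fun a b hab => this (by fin_cases a <;> fin_cases b <;> exact hab)
  have himg : ∀ i j l : ι, Finset.univ.image ![i, j, l] = {i, j, l} := fun i j l => by
    ext a; simp [Fin.exists_fin_succ, eq_comm]
  obtain ⟨y, hy, hdet⟩ := hx.exists_coordinates ![p, q, r] (hinj p q r hpqr)
    (by rwa [himg]) huniv
  refine ⟨y, ⟨?_, ?_, ?_⟩, fun i j l hn => ?_⟩
  · rw [show p = ![p, q, r] 0 from rfl, hy]; ext a; fin_cases a <;> simp
  · rw [show q = ![p, q, r] 1 from rfl, hy]; ext a; fin_cases a <;> simp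
  · rw [show r = ![p, q, r] 2 from rfl, hy]; ext a; fin_cases a <;> simp
  · rw [← himg, ← hdet _ (hinj i j l hn)]
    have : (fun a => y (![i, j, l] a)) = ![y i, y j, y l] := by
      ext a; fin_cases a <;> rfl
    rw [this]

theorem exists_coordinates_fin_four {ι : Type*} [DecidableEq ι] [Fintype ι]
    {𝒜 : Finset (Finset ι)} {h : IsPavingSets 4 𝒜} {x : ι → W}
    (hx : IsVectorRep K (pavingRank h).r x) (p q r s : ι) (hpqrs : [p, q, r, s].Nodup)
    (hpqrs' : {p, q, r, s} ∉ 𝒜) (huniv : Finset.univ ∉ 𝒜) :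
    ∃ y : ι → Fin 4 → K, (y p = ![1, 0, 0, 0] ∧ y q = ![0, 1, 0, 0] ∧ y r = ![0, 0, 1, 0] ∧
        y s = ![0, 0, 0, 1]) ∧
      ∀ i j l m : ι, [i, j, l, m].Nodup →
        ((Matrix.of ![y i, y j, y l, y m]).det = 0 ↔ {i, j, l, m} ∈ 𝒜) := by
  have hinj : ∀ i j l m : ι, [i, j, l, m].Nodup → Function.Injective ![i, j, l, m] :=
    fun i j l m hn => by
      have := List.nodup_iff_injective_get.1 hn
      exact fun a b hab => this (by fin_cases a <;> fin_cases b <;> exact hab)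
  have himg : ∀ i j l m : ι, Finset.univ.image ![i, j, l, m] = {i, j, l, m} := fun i j l m => by
    ext a; simp [Fin.exists_fin_succ, eq_comm]
  obtain ⟨y, hy, hdet⟩ := hx.exists_coordinates ![p, q, r, s] (hinj p q r s hpqrs)
    (by rwa [himg]) huniv
  refine ⟨y, ⟨?_, ?_, ?_, ?_⟩, fun i j l m hn => ?_⟩
  · rw [show p = ![p, q, r, s] 0 from rfl, hy]; ext a; fin_cases a <;> simp
  · rw [show q = ![p, q, r, s] 1 from rfl, hy]; ext a; fin_cases a <;> simp
  · rw [show r = ![p, q, r, s] 2 from rfl, hy]; ext a; fin_cases a <;> simp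
  · rw [show s = ![p, q, r, s] 3 from rfl, hy]; ext a; fin_cases a <;> simp
  · rw [← himg, ← hdet _ (hinj i j l m hn)]
    have : (fun a => y (![i, j, l, m] a)) = ![y i, y j, y l, y m] := by
      ext a; fin_cases a <;> rfl
    rw [this]

/-- Projectively, the coplanar lines `03` and `12` meet in a point. The line `45` is coplanar with
each of them but not contained in their plane, so it passes through that point; the same holds for
`67`. Then `45` and `67` meet, which makes `4567` coplanar although it is not in `vamosSets`. -/
theorem not_isVectorRep_vamos (x : Fin 8 → W) :
    ¬ IsVectorRep K (pavingRank vamosSets_paving).r x := by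
  intro hx
  obtain ⟨y, ⟨h0, h3, h1, h4⟩, hdet⟩ :=
    exists_coordinates_fin_four hx 0 3 1 4 (by decide) (by decide) (by decide)
  simp only [det_of_fin_four] at hdet
  have e1 := (hdet 0 3 1 2 (by decide)).2 (by decide)
  have e2 := (hdet 0 3 4 5 (by decide)).2 (by decide)
  have e3 := (hdet 1 2 4 5 (by decide)).2 (by decide)
  have e4 := (hdet 0 3 6 7 (by decide)).2 (by decide)
  have e5 := (hdet 1 2 6 7 (by decide)).2 (by decide)
  have n1 := mt (hdet 3 1 2 4 (by decide)).1 (by decide)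
  have n2 := mt (hdet 0 3 1 6 (by decide)).1 (by decide)
  have n3 := mt (hdet 4 5 6 7 (by decide)).1 (by decide)
  simp [h0, h1, h3, h4] at e1 e2 e3 e4 e5 n1 n2 n3
  rw [e1] at e5
  rw [e2] at n3
  -- `n1` and `n2` express that `4` and `6` lie off the plane `0123`. The product of these two
  -- nonzero coordinates with the determinant of `4567` is a combination of the three relations left
  -- after `e1` and `e2` are substituted.
  refine n3 ((mul_eq_zero.1 ?_).resolve_left (mul_ne_zero n1 n2))
  linear_combination (-(y 5 0) * y 6 2) * e5 - y 6 3 * (y 6 0 * y 7 2 - y 6 2 * y 7 0) * e3 +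
    y 5 0 * (y 2 0 * y 6 1 - y 2 1 * y 6 0) * e4

/-- Pappus' theorem in coordinates. -/
theorem pappus_identity {a b c d e f g h l m n p q r s t : K} (hb : b ≠ 0) (he : e ≠ 0)
    (hf : f ≠ 0) (hg : g ≠ 0) (e₁ : c * g - d * f = 0) (e₂ : d * q - e * p = 0)
    (e₃ : g * t - h * s = 0) (e₄ : -(a * s) + b * r = 0) (e₅ : h * l - f * n = 0)
    (e₆ : a * (d * n - e * m) - b * (c * n - e * l) = 0) :
    -(p * (r * n - t * l)) + q * (r * m - s * l) = 0 := by
  -- The nonvanishing hypotheses allow five of the relations to be solved for one coordinate each;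
  -- the claim then becomes a multiple of the sixth, `e₆`.
  obtain rfl : p = d * q / e := by field_simp; linear_combination -e₂
  obtain rfl : r = a * s / b := by field_simp; linear_combination e₄
  obtain rfl : t = h * s / g := by field_simp; linear_combination e₃
  obtain rfl : n = h * l / f := by field_simp; linear_combination -e₅
  obtain rfl : c = d * f / g := by field_simp; linear_combination e₁
  field_simp at e₆ ⊢
  linear_combination (-q * s) * e₆

/-- For the collinear triples `0, 1, 2` and `3, 4, 5`, the points `6`, `7`, `8` are the cross
intersections `04 ∩ 13`, `05 ∩ 23`, `15 ∩ 24`. Pappus' theorem makes them collinear, whereas `678`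
is not among the lines. -/
theorem not_isVectorRep_nonPappus (x : Fin 9 → W) :
    ¬ IsVectorRep K (pavingRank nonPappusLines_paving).r x := by
  intro hx
  obtain ⟨y, ⟨h0, h1, h3⟩, hdet⟩ :=
    exists_coordinates_fin_three hx 0 1 3 (by decide) (by decide) (by decide)
  simp only [det_of_fin_three] at hdet
  have e1 := (hdet 0 1 2 (by decide)).2 (by decide)
  have e2 := (hdet 3 4 5 (by decide)).2 (by decide)
  have e3 := (hdet 0 4 6 (by decide)).2 (by decide)
  have e4 := (hdet 1 3 6 (by decide)).2 (by decide)
  have e5 := (hdet 0 5 7 (by decide)).2 (by decide)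
  have e6 := (hdet 2 3 7 (by decide)).2 (by decide)
  have e7 := (hdet 1 5 8 (by decide)).2 (by decide)
  have e8 := (hdet 2 4 8 (by decide)).2 (by decide)
  have n1 := mt (hdet 6 7 8 (by decide)).1 (by decide)
  have n3 := mt (hdet 0 3 2 (by decide)).1 (by decide)
  have n6 := mt (hdet 0 1 4 (by decide)).1 (by decide)
  have n7 := mt (hdet 1 3 5 (by decide)).1 (by decide)
  have n8 := mt (hdet 0 3 5 (by decide)).1 (by decide)
  simp [h0, h1, h3] at e1 e2 e3 e4 e5 e6 e7 e8 n1 n3 n6 n7 n8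
  refine n1 ?_
  rw [e1, zero_mul, add_zero] at e8
  -- The letters are the coordinates `2 = (a, b, 0)`, `4 = (c, d, e)`, `5 = (f, g, h)`, `6 = (0, p,
  -- q)`, `7 = (r, s, t)`, `8 = (l, m, n)`; the two zeros come from `e1` and `e4`.
  have := pappus_identity n3 n6 n7 n8 e2 e3 e5 e6 e7 e8
  rw [e4]
  linear_combination this

/-- If at least six of the seven lines of the Fano plane are present, then the remaining line is
present iff a certain nonzero scalar is annihilated by `2`. -/
theorem exists_two_mul_eq_zero_iff {𝒜 : Finset (Finset (Fin 7))} {h : IsPavingSets 3 𝒜}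
    {x : Fin 7 → W} (hx : IsVectorRep K (pavingRank h).r x) (p : Equiv.Perm (Fin 7))
    (hp : fanoLines.image (Finset.image p) = fanoLines)
    (hsub : fanoLines.erase (Finset.image p {3, 4, 5}) ⊆ 𝒜) (hsup : 𝒜 ⊆ fanoLines) :
    ∃ c : K, c ≠ 0 ∧ (2 * c = 0 ↔ Finset.image p {3, 4, 5} ∈ 𝒜) := by
  have hinj := Finset.image_injective p.injective
  have hline : ∀ L ∈ fanoLines.erase {3, 4, 5}, L.image p ∈ 𝒜 := by
    intro L hL
    rw [Finset.mem_erase] at hL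
    refine hsub (Finset.mem_erase.2 ⟨fun hc => hL.1 (hinj hc), ?_⟩)
    rw [← hp]
    exact Finset.mem_image_of_mem _ hL.2
  have hnon : ∀ L, L ∉ fanoLines → L.image p ∉ 𝒜 := by
    intro L hL hc
    have hc' := hsup hc
    rw [← hp, hinj.mem_finset_image] at hc'
    exact hL hc'
  have hnd : ∀ i j l : Fin 7, [i, j, l].Nodup → [p i, p j, p l].Nodup := fun i j l hn =>
    List.Nodup.map p.injective hn
  have himg : ∀ i j l : Fin 7, ({p i, p j, p l} : Finset (Fin 7)) = Finset.image p {i, j, l} := by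
    intro i j l; simp
  have huniv : Finset.univ ∉ 𝒜 := fun hu => by
    have := h.card_eq _ hu
    simp at this
  obtain ⟨y, ⟨h0, h1, h2⟩, hdet⟩ := exists_coordinates_fin_three hx (p 0) (p 1) (p 2)
    (hnd 0 1 2 (by decide)) (by rw [himg]; exact hnon _ (by decide)) huniv
  simp only [det_of_fin_three] at hdet
  have hd : ∀ i j l : Fin 7, [i, j, l].Nodup → _ := fun i j l hn => hdet _ _ _ (hnd i j l hn)
  simp only [himg] at hd
  have e1 := (hd 0 1 3 (by decide)).2 (hline _ (by decide))
  have e2 := (hd 1 2 4 (by decide)).2 (hline _ (by decide))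
  have e3 := (hd 0 2 5 (by decide)).2 (hline _ (by decide))
  have e4 := (hd 2 3 6 (by decide)).2 (hline _ (by decide))
  have e5 := (hd 0 4 6 (by decide)).2 (hline _ (by decide))
  have e6 := (hd 1 5 6 (by decide)).2 (hline _ (by decide))
  have e7 := hd 3 4 5 (by decide)
  have n1 := mt (hd 1 2 3 (by decide)).1 (hnon _ (by decide))
  have n3 := mt (hd 0 2 4 (by decide)).1 (hnon _ (by decide))
  have n4 := mt (hd 0 1 5 (by decide)).1 (hnon _ (by decide))
  have n5 := mt (hd 0 1 6 (by decide)).1 (hnon _ (by decide))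
  have n6 := mt (hd 0 2 6 (by decide)).1 (hnon _ (by decide))
  have n7 := mt (hd 1 2 6 (by decide)).1 (hnon _ (by decide))
  simp only [h0, h1, h2] at e1 e2 e3 e4 e5 e6 n1 n3 n4 n5 n6 n7
  simp at e1 e2 e3 e4 e5 e6 n1 n3 n4 n5 n6 n7
  rw [e1, e2, e3] at e7
  -- After scaling, point `6` is `(1, 1, 1)` and points `3`, `4`, `5` are `(1, 1, 0)`, `(0, 1, 1)`,
  -- `(1, 0, 1)`, with determinant `2`. Without scaling, the determinant of `3, 4, 5` is the sum of
  -- these two products; their equality follows after cancelling the nonzero coordinates of point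
  -- `6`.
  have key : y (p 3) 0 * y (p 4) 1 * y (p 5) 2 = y (p 3) 1 * y (p 4) 2 * y (p 5) 0 := by
    refine mul_left_cancel₀ (mul_ne_zero (mul_ne_zero n5 n6) n7) ?_
    linear_combination y (p 4) 1 * y (p 6) 2 * y (p 5) 2 * y (p 6) 0 * e4 +
      y (p 3) 1 * y (p 6) 0 * y (p 5) 2 * y (p 6) 0 * e5 +
      y (p 3) 1 * y (p 6) 0 * y (p 4) 2 * y (p 6) 1 * e6
  refine ⟨_, mul_ne_zero (mul_ne_zero n1 n3) n4, ?_⟩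
  rw [← e7]
  refine Eq.congr_left ?_
  linear_combination key

theorem two_ne_zero_of_odd_ringChar (h : Odd (ringChar K)) : (2 : K) ≠ 0 := by
  intro h2
  have hdvd : ringChar K ∣ 2 := ringChar.dvd (by exact_mod_cast h2)
  rcases (Nat.dvd_prime Nat.prime_two).1 hdvd with h1 | h1
  · exact CharP.ringChar_ne_one h1
  · rw [h1] at h
    exact absurd h (by decide)

theorem not_isVectorRep_fano (h2 : (2 : K) ≠ 0) (x : Fin 7 → W) :
    ¬ IsVectorRep K (pavingRank fanoLines_paving).r x := by
  intro hx
  obtain ⟨c, hc, h⟩ := exists_two_mul_eq_zero_iff hx 1 (by decide) (Finset.erase_subset _ _)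
    subset_rfl
  exact mul_ne_zero h2 hc (h.2 (by decide))

/-- An automorphism of the Fano plane that permutes the lines cyclically. -/
def fanoRotation : Equiv.Perm (Fin 7) where
  toFun := ![1, 2, 3, 4, 6, 0, 5]
  invFun := ![5, 0, 1, 2, 3, 6, 4]
  left_inv := by decide
  right_inv := by decide

set_option maxRecDepth 10000 in
/-- The automorphism group of the Fano plane is transitive on lines. -/
theorem exists_perm_image_fanoLines {L : Finset (Fin 7)} (hL : L ∈ fanoLines) :
    ∃ p : Equiv.Perm (Fin 7), fanoLines.image (Finset.image p) = fanoLines ∧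
      Finset.image p {3, 4, 5} = L := by
  have hauto : fanoLines.image (Finset.image fanoRotation) = fanoLines := by decide
  have hpow : ∀ j : ℕ, fanoLines.image (Finset.image ⇑(fanoRotation ^ j)) = fanoLines := by
    intro j
    induction j with
    | zero => decide
    | succ j ih =>
      rw [pow_succ, Equiv.Perm.coe_mul]
      conv_rhs => rw [← ih, ← hauto]
      rw [Finset.image_image]
      congr 1
      ext1 A
      rw [Function.comp_apply, Finset.image_image]
  -- The rotation is a 7-cycle on the points, and its seven powers already carry `{3, 4, 5}` to
  -- every line.
  have htrans : ∀ L ∈ fanoLines, ∃ j : Fin 7,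
      Finset.image ⇑(fanoRotation ^ (j : ℕ)) {3, 4, 5} = L := by decide
  obtain ⟨j, hj⟩ := htrans L hL
  exact ⟨_, hpow j, hj⟩

/-- By symmetry of the Fano plane the omitted line may take the role of `{3, 4, 5}`; when `2 = 0`
the other six lines force it to be present. -/
theorem not_isVectorRep_nonFano (h2 : (2 : K) = 0) {L : Finset (Fin 7)} (hL : L ∈ fanoLines)
    (x : Fin 7 → W) : ¬ IsVectorRep K (pavingRank (nonFanoLines_paving L)).r x := by
  intro hx
  obtain ⟨p, hp, rfl⟩ := exists_perm_image_fanoLines hL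
  obtain ⟨c, -, h⟩ := exists_two_mul_eq_zero_iff hx p hp subset_rfl (Finset.erase_subset _ _)
  exact Finset.notMem_erase _ _ (h.1 (by rw [h2, zero_mul]))

end Configurations

/-! ### Transfer to both notions of representability, and the theorem -/

theorem even_natCard_iff_two_eq_zero (F : Type*) [Field F] [Finite F] :
    Even (Nat.card F) ↔ (2 : F) = 0 := by
  have := Fintype.ofFinite F
  rw [Nat.card_eq_fintype_card, Nat.even_iff, ← FiniteField.even_card_iff_char_two]
  constructor
  · intro h
    have h2 := CharP.cast_eq_zero F (ringChar F)
    rw [h] at h2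
    exact_mod_cast h2
  · intro h
    have hdvd : ringChar F ∣ 2 := ringChar.dvd (by exact_mod_cast h)
    exact ((Nat.dvd_prime Nat.prime_two).1 hdvd).resolve_left CharP.ringChar_ne_one

section

variable {F : Type*} {E : Type*} {ι : Type*} {K : Type w} [Field F] [AddCommGroup E] [Module F E]
  [FiniteDimensional F E] [DecidableEq ι] {k : ℕ} {𝒜 : Finset (Finset ι)}

theorem not_isRepresentableOver_pavingMatroid [Field K] (h : IsPavingSets k 𝒜)
    (hK : ∀ {W : Type w} [AddCommGroup W] [Module K W] (x : ι → W),
      ¬ IsVectorRep K (pavingRank h).r x) :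
    ¬ (pavingMatroid k 𝒜 h).IsRepresentableOver K := fun hrep => by
  obtain ⟨_, x, hx⟩ := (pavingRank h).exists_isVectorRep_of_isRepresentableOver hrep
  exact hK x hx

theorem inducedMatroid_pavingQMatroid (b : Basis ι F E) (h : IsPavingSets k 𝒜) :
    (pavingQMatroid k (spanFamily b 𝒜) (h.spanFamily b)).inducedMatroid b =
      pavingMatroid k 𝒜 h := by
  rw [QMatroid.inducedMatroid, inducedRank_pavingQMatroid, pavingMatroid]

theorem not_isRepresentableOver_pavingQMatroid [Field K] [Algebra F K] [FiniteDimensional F K]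
    (b : Basis ι F E) (h : IsPavingSets k 𝒜)
    (hK : ∀ {W : Type w} [AddCommGroup W] [Module K W] (x : ι → W),
      ¬ IsVectorRep K (pavingRank h).r x) :
    ¬ (pavingQMatroid k (spanFamily b 𝒜) (h.spanFamily b)).IsRepresentableOver K := fun hrep => by
  obtain ⟨W, _, _, x, hx⟩ := QMatroid.exists_isVectorRep_of_isRepresentableOver _ b hrep
  rw [inducedRank_pavingQMatroid b h] at hx
  exact hK x hx

end

theorem mainTheorem3 {F : Type u} [Field F] [Finite F] :
    -- the Vámos matroid, any `q`
    ((∀ (K : Type v) [Field K], ¬ vamosMatroid.IsRepresentableOver K) ∧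
      ∀ b : Module.Basis (Fin 8) F (Fin 8 → F),
        (vamosQMatroid b).inducedMatroid b = vamosMatroid ∧
          ∀ (K : Type w) [Field K] [Algebra F K] [FiniteDimensional F K],
            ¬ (vamosQMatroid b).IsRepresentableOver K) ∧
    -- the non-Pappus matroid, any `q`
    ((∀ (K : Type v) [Field K], ¬ nonPappusMatroid.IsRepresentableOver K) ∧
      ∀ b : Module.Basis (Fin 9) F (Fin 9 → F),
        (nonPappusQMatroid b).inducedMatroid b = nonPappusMatroid ∧
          ∀ (K : Type w) [Field K] [Algebra F K] [FiniteDimensional F K],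
            ¬ (nonPappusQMatroid b).IsRepresentableOver K) ∧
    -- the Fano matroid, `q` odd
    ((∀ (K : Type v) [Field K], Odd (ringChar K) →
        ¬ fanoMatroid.IsRepresentableOver K) ∧
      ∀ b : Module.Basis (Fin 7) F (Fin 7 → F),
        (fanoQMatroid b).inducedMatroid b = fanoMatroid ∧
          (Odd (Nat.card F) →
            ∀ (K : Type w) [Field K] [Algebra F K] [FiniteDimensional F K],
              ¬ (fanoQMatroid b).IsRepresentableOver K)) ∧
    -- the non-Fano matroid (any one of the seven lines omitted), `q` even
    (∀ L ∈ fanoLines,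
      (∀ (K : Type v) [Field K], ringChar K = 2 →
        ¬ (nonFanoMatroid L).IsRepresentableOver K) ∧
      ∀ b : Module.Basis (Fin 7) F (Fin 7 → F),
        (nonFanoQMatroid L b).inducedMatroid b = nonFanoMatroid L ∧
          (Even (Nat.card F) →
            ∀ (K : Type w) [Field K] [Algebra F K] [FiniteDimensional F K],
              ¬ (nonFanoQMatroid L b).IsRepresentableOver K)) ∧
    -- over every finite field, some `q`-matroid is not representable over any `F_{q^m}`
    (∃ (n : ℕ) (M : QMatroid F (Fin n → F)),
      ∀ (K : Type w) [Field K] [Algebra F K] [FiniteDimensional F K],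
        ¬ M.IsRepresentableOver K) := by
  -- This serves twice: for the Vámos clause and, with the standard basis, for the example over
  -- every finite field.
  have hvamos : ∀ (b : Basis (Fin 8) F (Fin 8 → F)) (K : Type w) [Field K] [Algebra F K]
      [FiniteDimensional F K], ¬ (vamosQMatroid b).IsRepresentableOver K := fun b K _ _ _ =>
    not_isRepresentableOver_pavingQMatroid b vamosSets_paving not_isVectorRep_vamos
  refine ⟨⟨fun K _ => not_isRepresentableOver_pavingMatroid _ not_isVectorRep_vamos,
      fun b => ⟨inducedMatroid_pavingQMatroid b _, hvamos b⟩⟩,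
    ⟨fun K _ => not_isRepresentableOver_pavingMatroid _ not_isVectorRep_nonPappus,
      fun b => ⟨inducedMatroid_pavingQMatroid b _, fun K _ _ _ =>
        not_isRepresentableOver_pavingQMatroid b _ not_isVectorRep_nonPappus⟩⟩,
    ⟨fun K _ hK => not_isRepresentableOver_pavingMatroid _
        (not_isVectorRep_fano (two_ne_zero_of_odd_ringChar hK)),
      fun b => ⟨inducedMatroid_pavingQMatroid b _, fun hF K _ _ _ => ?_⟩⟩,
    fun L hL => ⟨fun K _ hK => ?_,
      fun b => ⟨inducedMatroid_pavingQMatroid b _, fun hF K _ _ _ => ?_⟩⟩,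
    ⟨8, vamosQMatroid (Pi.basisFun F (Fin 8)), hvamos _⟩⟩
  · rw [← Nat.not_even_iff_odd, even_natCard_iff_two_eq_zero] at hF
    refine not_isRepresentableOver_pavingQMatroid b _ (not_isVectorRep_fano fun h => hF ?_)
    -- Since `F` embeds in `K`, the vanishing of `2` in `K` descends to `F`.
    exact (algebraMap F K).injective (by rw [map_ofNat, map_zero, h])
  · have h2 := CharP.cast_eq_zero K (ringChar K)
    rw [hK] at h2
    exact not_isRepresentableOver_pavingMatroid _
      (not_isVectorRep_nonFano (by exact_mod_cast h2) hL)
  · rw [even_natCard_iff_two_eq_zero] at hF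
    refine not_isRepresentableOver_pavingQMatroid b _ (not_isVectorRep_nonFano ?_ hL)
    rw [← map_ofNat (algebraMap F K), hF, map_zero]
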